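/- All groups are regarded as discrete groups, $H^\bullet(G,M)$ denotes group cohomology, and for a $G$-set $X$, $\mathbb C[X]$ denotes the $\mathbb C$-vector space with basis $X$ (finite formal linear combinations), with $G$ acting by permuting the basis. (a) For every positive integer $p$, let $\mathbb R^p$ be the additive group, acting on itself by translation. Then $$H^k(\mathbb R^p,\mathbb C[\mathbb R^p])=0\quad\text{for all } k\ge 0.$$ (b) Equip $\mathbb R^{2n}$, with coordinates $(x,\xi)\in\mathbb R^n\oplus\mathbb R^n$, with its standard symplectic form, and let $\Lambda(n)$ be the Lagrangian Grassmannian, i.e. the set of Lagrangian linear subspaces of $\mathbb R^{2n}$. Let $\operatorname{MPar}(n,\mathbb R)$ be the group, under componentwise multiplication, of pairs $(A,z)$ where $$A=\begin{pmatrix} b & a\\ 0 & (b^{-1})^t\end{pmatrix}\in \operatorname{Sp}(2n,\mathbb R),\qquad z\in\mathbb C^\times,\qquad \det(b)^2=z^4,$$ acting on $\Lambda(n)$ by $(A,z)\cdot L=A(L)$. If $\Omega\subset\Lambda(n)$ is an orbit of $\operatorname{MPar}(n,\mathbb R)$ with more than one point, then $$H^k(\operatorname{MPar}(n,\mathbb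 R),\mathbb C[\Omega])=0\quad\text{for all } k\ge 0.$$ -/

import Mathlib

open Matrix

/-- The standard symplectic form `ω(v, w) = vᵀ J w` on `ℝ²ⁿ = ℝⁿ ⊕ ℝⁿ`, with coordinates
`(x, ξ)`: `x` is the `Sum.inl` part of a vector and `ξ` is its `Sum.inr` part. -/
noncomputable def symplecticForm (n : ℕ) : LinearMap.BilinForm ℝ (Fin n ⊕ Fin n → ℝ) :=
  Matrix.toBilin' (Matrix.J (Fin n) ℝ)

/-- The Lagrangian Grassmannian `Λ(n)`: the set of linear subspaces of `ℝ²ⁿ` which are equal to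
their own orthogonal with respect to the symplectic form. -/
def LagrangianGrassmannian (n : ℕ) : Type :=
  {L : Submodule ℝ (Fin n ⊕ Fin n → ℝ) // (symplecticForm n).orthogonal L = L}

theorem symplecticForm_mulVec {n : ℕ} (A : Matrix.symplecticGroup (Fin n) ℝ)
    (v w : Fin n ⊕ Fin n → ℝ) :
    symplecticForm n (A.1 *ᵥ v) (A.1 *ᵥ w) = symplecticForm n v w := by
  have h : A.1ᵀ * Matrix.J (Fin n) ℝ * A.1 = Matrix.J (Fin n) ℝ :=
    SymplecticGroup.mem_iff'.1 A.2
  simp only [symplecticForm, Matrix.toBilin'_apply']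
  rw [Matrix.mulVec_mulVec, ← Matrix.vecMul_transpose, ← Matrix.dotProduct_mulVec,
    Matrix.mulVec_mulVec, ← Matrix.mul_assoc, h]

/-- The real symplectic group acts on the Lagrangian Grassmannian by `A • L = A(L)`. -/
noncomputable instance lagrangianGrassmannianAction (n : ℕ) :
    MulAction (Matrix.symplecticGroup (Fin n) ℝ) (LagrangianGrassmannian n) where
  smul A L := ⟨L.1.map (Matrix.mulVecLin A.1), by
    have hinv : A.1 * (A⁻¹).1 = 1 := congrArg Subtype.val (mul_inv_cancel A)
    ext w
    have hw : A.1 *ᵥ ((A⁻¹).1 *ᵥ w) = w := by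
      rw [Matrix.mulVec_mulVec, hinv, Matrix.one_mulVec]
    have key : w ∈ (symplecticForm n).orthogonal (L.1.map (Matrix.mulVecLin A.1)) ↔
        (A⁻¹).1 *ᵥ w ∈ (symplecticForm n).orthogonal L.1 := by
      simp only [LinearMap.BilinForm.mem_orthogonal_iff,
        Submodule.mem_map, forall_exists_index, and_imp, forall_apply_eq_imp_iff₂,
        Matrix.mulVecLin_apply]
      refine forall₂_congr fun v _ => ?_
      rw [← symplecticForm_mulVec A v, hw]
    rw [key, L.2]
    constructor
    · intro h
      exact ⟨_, h, hw⟩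
    · rintro ⟨v, hv, rfl⟩
      have hinv' : (A⁻¹).1 * A.1 = 1 := congrArg Subtype.val (inv_mul_cancel A)
      rw [Matrix.mulVecLin_apply, Matrix.mulVec_mulVec, hinv', Matrix.one_mulVec]
      exact hv⟩
  one_smul L := Subtype.ext <| by
    change L.1.map (Matrix.mulVecLin 1) = L.1
    rw [Matrix.mulVecLin_one, Submodule.map_id]
  mul_smul A B L := Subtype.ext <| by
    change L.1.map (Matrix.mulVecLin (A.1 * B.1)) =
      (L.1.map (Matrix.mulVecLin B.1)).map (Matrix.mulVecLin A.1)
    rw [Matrix.mulVecLin_mul, Submodule.map_comp]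

/-- The group `MPar(n, ℝ)` of pairs `(A, z)`, where `A` is a symplectic matrix of the form
`[b, a; 0, (b⁻¹)ᵗ]` and `z` is a (nonzero) complex number with `det(b)² = z⁴`; the product of pairs
is taken componentwise. -/
def MPar (n : ℕ) : Subgroup (Matrix.symplecticGroup (Fin n) ℝ × ℂˣ) where
  carrier := {g | ∃ b a : Matrix (Fin n) (Fin n) ℝ,
    g.1.1 = Matrix.fromBlocks b a 0 (b⁻¹)ᵀ ∧ ((b.det : ℝ) : ℂ) ^ 2 = (g.2 : ℂ) ^ 4}
  one_mem' := ⟨1, 0, by simp, by simp⟩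
  mul_mem' := by
    rintro ⟨A, z⟩ ⟨A', z'⟩ ⟨b, a, hA, hz⟩ ⟨b', a', hA', hz'⟩
    refine ⟨b * b', b * a' + a * (b'⁻¹)ᵀ, ?_, ?_⟩
    · change A.1 * A'.1 = _
      simp only at hA hA'
      rw [hA, hA', Matrix.fromBlocks_multiply, Matrix.mul_inv_rev, Matrix.transpose_mul]
      simp
    · simp only [Matrix.det_mul, Prod.mk_mul_mk, Units.val_mul, mul_pow, Complex.ofReal_mul] at *
      rw [hz, hz']
  inv_mem' := by
    rintro ⟨A, z⟩ ⟨b, a, hA, hz⟩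
    simp only at hA hz
    have hb : IsUnit b.det := by
      refine isUnit_iff_ne_zero.2 fun h => ?_
      rw [h] at hz
      exact pow_ne_zero 4 z.ne_zero (by rw [← hz]; simp)
    have hbt : IsUnit bᵀ.det := by rwa [Matrix.det_transpose]
    refine ⟨b⁻¹, -(b⁻¹ * a * bᵀ), ?_, ?_⟩
    · have h1 : A.1 * (A⁻¹).1 = 1 := congrArg Subtype.val (mul_inv_cancel A)
      have h2 : Matrix.fromBlocks b⁻¹ (-(b⁻¹ * a * bᵀ)) 0 bᵀ * A.1 = 1 := by
        rw [hA, Matrix.fromBlocks_multiply, Matrix.transpose_nonsing_inv]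
        simp [Matrix.nonsing_inv_mul _ hb, Matrix.mul_assoc, Matrix.mul_nonsing_inv _ hbt,
          ← Matrix.fromBlocks_one]
      rw [Matrix.nonsing_inv_nonsing_inv _ hb]
      exact (left_inv_eq_right_inv h2 h1).symm
    · simp only [Matrix.det_nonsing_inv, Prod.inv_mk, Units.val_inv_eq_inv_val, inv_pow,
        Ring.inverse_eq_inv', Complex.ofReal_inv] at *
      rw [hz]

/-- `MPar(n, ℝ)` acts on the Lagrangian Grassmannian through its projection to the symplectic
group: `(A, z) • L = A(L)`. -/
noncomputable instance mparAction (n : ℕ) : MulAction (MPar n) (LagrangianGrassmannian n) :=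
  MulAction.compHom (LagrangianGrassmannian n)
    ((MonoidHom.fst (Matrix.symplecticGroup (Fin n) ℝ) ℂˣ).comp (MPar n).subtype)

/-! A central `t` acts trivially on `H^*(G, A)` (`map_centralEnd`), so `t - 1` induces zero there.
If every point of `X` has trivial stabilizer in `ℤ` acting through `t`, then `0 → k[X] → k[X] →
k[X/t] → 0`, with first map `t - 1`, is exact, and its long exact sequence gives `H^{n+1}(k[X]) = 0`
once `H^n(k[X/t]) = 0`. In degree 0, a finitely supported invariant function vanishes because
`t`-orbits are infinite.

Iterating needs a fresh `t` for each quotient. A central copy of `ℝ` supplies it: each quotient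
enlarges the stabilizers by at most a rational line, so they stay in a countable `ℚ`-subspace, and
`ℝ` is uncountable.

Translations give (a). In (b) the shears are central only in the abelian normal unipotent subgroup,
and they move every Lagrangian not inside `ξ = 0`; a Lagrangian inside `ξ = 0` is a fixed point,
excluded by nontriviality. `isZero_of_normal` carries the vanishing up to `MPar n`. -/

namespace Rep

/-! ### Central elements act trivially on cohomology. -/

open CategoryTheory Limits groupCohomology

variable {k G : Type} [CommRing k] [Group G]

/-- The action of a central element of `G` on a representation, as an endomorphism. -/
noncomputable def centralEnd {t : G} (ht : t ∈ Subgroup.center G) (A : Rep.{0} k G) : A ⟶ A :=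
  Rep.ofHom ⟨A.ρ t, fun g => by
    rw [← Module.End.mul_eq_comp, ← Module.End.mul_eq_comp, ← map_mul, ← map_mul,
      Subgroup.mem_center_iff.1 ht g]⟩

lemma centralEnd_naturality {t : G} (ht : t ∈ Subgroup.center G) {A B : Rep.{0} k G} (f : A ⟶ B) :
    f ≫ centralEnd ht B = centralEnd ht A ≫ f := by
  ext x
  exact (hom_comm_apply f t x).symm

/-- The unit of the adjunction between restriction to a subgroup and coinduction. -/
noncomputable abbrev toCoindRes (S : Subgroup G) (A : Rep.{0} k G) :
    A ⟶ coind S.subtype (res S.subtype A) :=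
  resCoindToHom S.subtype A (res S.subtype A) (𝟙 _)

instance mono_toCoindRes (S : Subgroup G) (A : Rep.{0} k G) : Mono (toCoindRes S A) := by
  rw [Rep.mono_iff_injective]
  intro a b h
  have h1 : A.ρ 1 a = A.ρ 1 b := congrFun (congrArg Subtype.val h) 1
  simpa using h1

/-- The short complex `A ⟶ coind A ⟶ Q`. -/
noncomputable abbrev coindSequence (S : Subgroup G) (A : Rep.{0} k G) :
    ShortComplex (Rep.{0} k G) :=
  ShortComplex.mk (toCoindRes S A) (cokernel.π (toCoindRes S A)) (cokernel.condition _)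

lemma coindSequence_shortExact (S : Subgroup G) (A : Rep.{0} k G) :
    (coindSequence S A).ShortExact where
  exact := ShortComplex.exact_cokernel _
  mono_f := mono_toCoindRes S A
  epi_g := inferInstanceAs (Epi (cokernel.π _))

/-- Dimension shifting: the claim is clear on invariants, and the action of `t` commutes with
connecting maps. -/
lemma map_centralEnd {t : G} (ht : t ∈ Subgroup.center G) (n : ℕ) (A : Rep.{0} k G) :
    groupCohomology.map (MonoidHom.id G) (centralEnd ht A) n = 𝟙 _ := by
  induction n generalizing A with
  | zero =>
    rw [← cancel_mono (H0Iso A).hom]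
    erw [map_id_comp_H0Iso_hom]
    rw [Category.id_comp]
    have : (invariantsFunctor k G).map (centralEnd ht A) = 𝟙 _ := by
      ext x
      exact Subtype.ext (x.2 t)
    rw [this]
    exact Category.comp_id _
  | succ n ih =>
    -- Coinduction from the trivial subgroup is acyclic in positive degrees, so `δ` is onto.
    have hS := coindSequence_shortExact ⊥ A
    have := epi_δ_of_isZero hS n
      ((isZero_groupCohomology_succ_of_subsingleton _ n).of_iso (groupCohomology.coindIso _ _))
    have h := δ_naturality hS hS
      { τ₁ := centralEnd ht _, τ₂ := centralEnd ht _, τ₃ := centralEnd ht _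
        comm₁₂ := (centralEnd_naturality ht _).symm
        comm₂₃ := (centralEnd_naturality ht _).symm } n (n + 1) rfl
    dsimp only at h
    rw [ih] at h
    rw [← cancel_epi (δ hS n (n + 1) rfl)]
    exact h.trans ((Category.id_comp _).trans (Category.comp_id _).symm)

lemma map_centralEnd_sub_id {t : G} (ht : t ∈ Subgroup.center G) (n : ℕ) (A : Rep.{0} k G) :
    groupCohomology.map (MonoidHom.id G) (centralEnd ht A - 𝟙 A) n = 0 := by
  have : cochainsMap (MonoidHom.id G) (centralEnd ht A - 𝟙 A) =
      cochainsMap (MonoidHom.id G) (centralEnd ht A) - cochainsMap (MonoidHom.id G) (𝟙 A) := rfl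
  rw [groupCohomology.map, this]
  exact (HomologicalComplex.homologyMap_sub _ _ _).trans
    (sub_eq_zero.2 ((map_centralEnd ht n A).trans (groupCohomology.map_id (B := A) n).symm))

lemma isZero_succ_of_centralEnd {t : G} (ht : t ∈ Subgroup.center G) {A Q : Rep.{0} k G}
    (π : A ⟶ Q) (w : (centralEnd ht A - 𝟙 A) ≫ π = 0)
    (hS : (ShortComplex.mk _ π w).ShortExact) (n : ℕ) (hQ : IsZero (groupCohomology Q n)) :
    IsZero (groupCohomology A (n + 1)) := by
  -- The map induced by `t - 1` is injective by exactness, yet zero.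
  have h := (mapShortComplex₁_exact hS (rfl : n + 1 = n + 1)).mono_g (hQ.eq_of_src _ _)
  exact @IsZero.of_mono_eq_zero _ _ _ _ _ _ h (map_centralEnd_sub_id ht (n + 1) A)

lemma isZero_zero_iff (A : Rep.{0} k G) :
    IsZero (groupCohomology A 0) ↔ ∀ a : A, (∀ g, A.ρ g a = a) → a = 0 := by
  rw [(H0Iso A).isZero_iff, ModuleCat.isZero_iff_subsingleton]
  constructor
  · intro h a ha
    exact congrArg Subtype.val (Subsingleton.elim (⟨a, ha⟩ : A.ρ.invariants) 0)
  · intro h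
    exact ⟨fun a b => Subtype.ext ((h _ a.2).trans (h _ b.2).symm)⟩

lemma isZero_succ_iff (A : Rep.{0} k G) (n : ℕ) :
    IsZero (groupCohomology A (n + 1)) ↔ ∀ x : (Fin (n + 1) → G) → A,
      inhomogeneousCochains.d A (n + 1) x = 0 → ∃ y, inhomogeneousCochains.d A n y = x := by
  unfold groupCohomology
  rw [← HomologicalComplex.exactAt_iff_isZero_homology,
    HomologicalComplex.exactAt_iff' _ n (n + 1) (n + 2) (by simp) (by simp),
    ShortComplex.moduleCat_exact_iff]
  rw [← inhomogeneousCochains.d_def, ← inhomogeneousCochains.d_def]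
  rfl

end Rep

/-! ### The operator `t - 1` on finitely supported functions. -/

section FinsuppLemmas

variable {k G X : Type} [CommRing k] [Group G] [MulAction G X]

/-- An invariant function is constant on `t`-orbits, which are infinite, while its support is
finite. -/
lemma Finsupp.eq_zero_of_mapDomain_smul_eq {t : G} (hfree : ∀ (x : X) (m : ℤ), t ^ m • x = x → m = 0)
    (f : X →₀ k) (hf : Finsupp.mapDomain (t • ·) f = f) : f = 0 := by
  have h1 (x : X) : f (t • x) = f x := by
    conv_lhs => rw [← hf]
    exact Finsupp.mapDomain_apply (MulAction.injective t) f x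
  have h2 (x : X) (m : ℤ) : f (t ^ m • x) = f x := by
    induction m with
    | zero => simp
    | succ m ih => rw [add_comm, _root_.zpow_add, zpow_one, mul_smul, h1, ih]
    | pred m ih => rw [← ih, ← h1, smul_smul, ← _root_.zpow_one_add, add_sub_cancel]
  ext x
  by_contra hx
  refine (Set.infinite_of_injective_forall_mem (f := fun m : ℤ => t ^ m • x) ?_ ?_)
    f.hasFiniteSupport
  · intro a b hab
    have : t ^ (a - b) • x = x := by
      rw [sub_eq_neg_add, _root_.zpow_add, mul_smul]
      simp only at hab
      rw [hab, _root_.zpow_neg, inv_smul_smul]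
    exact sub_eq_zero.1 (hfree x _ this)
  · intro m
    simpa [h2] using hx

/-- Modulo the image of `t - 1`, each point equals the chosen representative of its orbit, so `f` is
congruent to the lift of its pushforward, which is zero. -/
lemma Finsupp.exists_mapDomain_smul_sub_eq {Y : Type} (t : G) (q : X → Y)
    (hsurj : Function.Surjective q) (hq : ∀ x x', q x = q x' → ∃ m : ℤ, t ^ m • x = x')
    (f : X →₀ k) (hf : Finsupp.mapDomain q f = 0) :
    ∃ u : X →₀ k, Finsupp.mapDomain (t • ·) u - u = f := by
  obtain ⟨s, hs⟩ := hsurj.hasRightInverse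
  let D : (X →₀ k) →ₗ[k] (X →₀ k) := Finsupp.lmapDomain k k (t • ·) - LinearMap.id
  have hpow (x : X) (c : k) (m : ℤ) :
      Finsupp.single (t ^ m • x) c - Finsupp.single x c ∈ LinearMap.range D := by
    have hstep (x : X) : Finsupp.single (t • x) c - Finsupp.single x c ∈ LinearMap.range D :=
      ⟨Finsupp.single x c, by simp [D]⟩
    induction m with
    | zero => simp
    | succ m ih =>
      have := add_mem (hstep (t ^ (m : ℤ) • x)) ih
      rwa [smul_smul, ← _root_.zpow_one_add, add_comm 1, sub_add_sub_cancel] at this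
    | pred m ih =>
      have := sub_mem ih (hstep (t ^ (-(m : ℤ) - 1) • x))
      rw [smul_smul, ← _root_.zpow_one_add, add_sub_cancel] at this
      simpa using this
  have key (g : X →₀ k) : Finsupp.mapDomain (s ∘ q) g - g ∈ LinearMap.range D := by
    induction g using Finsupp.induction_linear with
    | zero => simp
    | add a b ha hb =>
      rw [Finsupp.mapDomain_add, add_sub_add_comm]
      exact add_mem ha hb
    | single x c =>
      obtain ⟨m, hm⟩ := hq x (s (q x)) (hs (q x)).symm
      rw [Finsupp.mapDomain_single, Function.comp_apply, ← hm]
      exact hpow x c m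
  have := neg_mem (key f)
  rw [Finsupp.mapDomain_comp, hf, Finsupp.mapDomain_zero, zero_sub, neg_neg] at this
  exact this

end FinsuppLemmas

/-! ### Permutation representations and quotients by central elements. -/

namespace Rep

open CategoryTheory Limits groupCohomology

variable {k G X Y : Type} [CommRing k] [Group G] [MulAction G X] [MulAction G Y]

/-- The map of permutation representations induced by an equivariant map. -/
noncomputable def ofMulActionMap (q : X →[G] Y) : ofMulAction k G X ⟶ ofMulAction k G Y :=
  Rep.ofHom ⟨(MonoidAlgebra.coeffLinearEquiv k).symm.toLinearMap ∘ₗ Finsupp.lmapDomain k k q ∘ₗ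
    (MonoidAlgebra.coeffLinearEquiv k).toLinearMap, fun g => by ext; simp⟩

lemma isZero_ofMulAction_succ {t : G} (ht : t ∈ Subgroup.center G) (q : X →[G] Y)
    (hsurj : Function.Surjective q) (hq : ∀ x x', q x = q x' ↔ ∃ m : ℤ, t ^ m • x = x')
    (hfree : ∀ (x : X) (m : ℤ), t ^ m • x = x → m = 0) (n : ℕ)
    (hY : IsZero (groupCohomology (ofMulAction k G Y) n)) :
    IsZero (groupCohomology (ofMulAction k G X) (n + 1)) := by
  have w : (centralEnd ht (ofMulAction k G X) - 𝟙 _) ≫ ofMulActionMap q = 0 := by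
    rw [Preadditive.sub_comp, sub_eq_zero]
    apply Rep.hom_ext
    apply Representation.IntertwiningMap.ext
    refine LinearMap.ext fun v => ?_
    apply MonoidAlgebra.coeff_injective
    change Finsupp.mapDomain q (Finsupp.mapDomain (t • ·) _) = Finsupp.mapDomain q _
    rw [← Finsupp.mapDomain_comp]
    congr 1
    ext x
    exact (hq _ _).2 ⟨-1, by simp⟩
  refine isZero_succ_of_centralEnd ht (ofMulActionMap q) w
    { exact := ?_, mono_f := ?_, epi_g := ?_ } n hY
  · rw [← ShortComplex.exact_map_iff_of_faithful _ (forget₂ (Rep k G) (ModuleCat k)),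
      ShortComplex.moduleCat_exact_iff]
    intro v hv
    obtain ⟨u, hu⟩ := Finsupp.exists_mapDomain_smul_sub_eq t q hsurj (fun x x' => (hq x x').1)
      (MonoidAlgebra.coeff (R := k) (M := X) v)
      (congrArg (MonoidAlgebra.coeff (R := k) (M := Y)) hv)
    exact ⟨MonoidAlgebra.ofCoeff u, MonoidAlgebra.coeff_injective hu⟩
  · rw [Rep.mono_iff_injective, injective_iff_map_eq_zero]
    intro v hv
    apply MonoidAlgebra.coeff_injective
    refine Finsupp.eq_zero_of_mapDomain_smul_eq hfree _ (sub_eq_zero.1 ?_)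
    exact congrArg (MonoidAlgebra.coeff (R := k) (M := X)) hv
  · rw [Rep.epi_iff_surjective]
    intro y
    obtain ⟨f, hf⟩ := Finsupp.mapDomain_surjective hsurj (MonoidAlgebra.coeff (R := k) (M := Y) y)
    exact ⟨MonoidAlgebra.ofCoeff f, MonoidAlgebra.coeff_injective hf⟩

lemma isZero_ofMulAction_zero {t : G}
    (hfree : ∀ (x : X) (m : ℤ), t ^ m • x = x → m = 0) :
    IsZero (groupCohomology (ofMulAction k G X) 0) := by
  rw [isZero_zero_iff]
  intro v hv
  exact MonoidAlgebra.coeff_injective (Finsupp.eq_zero_of_mapDomain_smul_eq hfree _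
    (congrArg (MonoidAlgebra.coeff (R := k) (M := X)) (hv t)))

/-- The quotient of a `G`-set by the action of a central element. -/
abbrev CentralQuotient (t : G) (X : Type) [MulAction G X] : Type :=
  MulAction.orbitRel.Quotient (Subgroup.zpowers t) X

lemma centralQuotient_mk_eq_iff (t : G) (x x' : X) :
    (Quotient.mk'' x : CentralQuotient t X) = Quotient.mk'' x' ↔ ∃ m : ℤ, t ^ m • x = x' := by
  rw [eq_comm, Quotient.eq'', MulAction.orbitRel_apply]
  constructor
  · rintro ⟨⟨_, m, rfl⟩, h⟩
    exact ⟨m, h⟩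
  · rintro ⟨m, h⟩
    exact ⟨⟨_, m, rfl⟩, h⟩

/-- The action of `G` on the quotient of a `G`-set by a central element. -/
@[reducible] def centralQuotientAction {t : G} (ht : t ∈ Subgroup.center G) :
    MulAction G (CentralQuotient t X) where
  smul g := _root_.Quotient.map' (g • ·) fun x x' h => by
    rw [← Quotient.eq''] at h ⊢
    obtain ⟨m, rfl⟩ := (centralQuotient_mk_eq_iff t _ _).1 h
    refine (centralQuotient_mk_eq_iff t _ _).2 ⟨m, ?_⟩
    rw [smul_smul, smul_smul, Subgroup.mem_center_iff.1 (zpow_mem ht m) g]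
  one_smul := by
    rintro ⟨x⟩
    exact congrArg Quotient.mk'' (one_smul G x)
  mul_smul g h := by
    rintro ⟨x⟩
    exact congrArg Quotient.mk'' (mul_smul g h x)

/-- If the reals act centrally on a `G`-set with all stabilizers in a countable rational subspace,
then the cohomology of the permutation representation vanishes. -/
theorem isZero_ofMulAction_of_countable_stabilizers (φ : Multiplicative ℝ →* G)
    (hφ : ∀ r, φ r ∈ Subgroup.center G) (n : ℕ) (X : Type) [MulAction G X] (B : Submodule ℚ ℝ)
    (hB : (B : Set ℝ).Countable)
    (hX : ∀ (x : X) (r : ℝ), φ (Multiplicative.ofAdd r) • x = x → r ∈ B) :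
    IsZero (groupCohomology (ofMulAction k G X) n) := by
  have htpow (r : ℝ) (m : ℤ) :
      φ (Multiplicative.ofAdd r) ^ m = φ (Multiplicative.ofAdd ((m : ℝ) * r)) := by
    rw [← map_zpow, ← ofAdd_zsmul, zsmul_eq_mul]
  have hexists (X : Type) [MulAction G X] (B : Submodule ℚ ℝ) (hB : (B : Set ℝ).Countable)
      (hX : ∀ (x : X) (r : ℝ), φ (Multiplicative.ofAdd r) • x = x → r ∈ B) :
      ∃ r, ∀ (x : X) (m : ℤ), φ (Multiplicative.ofAdd r) ^ m • x = x → m = 0 := by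
    obtain ⟨r, hr⟩ : ∃ r, r ∉ B := by
      by_contra! h
      exact Set.not_countable_univ (α := ℝ) (hB.mono fun x _ => h x)
    refine ⟨r, fun x m h => ?_⟩
    by_contra hm
    rw [htpow] at h
    apply hr
    -- Rationality of `B` allows division by `m`.
    have := B.smul_mem (m : ℚ)⁻¹ (hX x _ h)
    rw [Rat.smul_def] at this
    push_cast at this
    rwa [inv_mul_cancel_left₀ (by exact_mod_cast hm)] at this
  induction n generalizing X B with
  | zero =>
    obtain ⟨r, hr⟩ := hexists X B hB hX
    exact isZero_ofMulAction_zero hr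
  | succ n ih =>
    obtain ⟨r, hr⟩ := hexists X B hB hX
    let t := φ (Multiplicative.ofAdd r)
    let _ : MulAction G (CentralQuotient t X) := centralQuotientAction (hφ _)
    let q : X →[G] CentralQuotient t X := ⟨Quotient.mk'', fun _ _ => rfl⟩
    refine isZero_ofMulAction_succ (hφ (Multiplicative.ofAdd r)) q Quotient.mk''_surjective
      (centralQuotient_mk_eq_iff t) hr n (ih _ (B ⊔ Submodule.span ℚ {r}) ?_ ?_)
    · refine (hB.prod (Set.countable_univ (α := ℚ))).image (fun p => p.1 + p.2 • r) |>.mono ?_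
      intro x hx
      obtain ⟨b, hb, y, hy, rfl⟩ := Submodule.mem_sup.1 hx
      obtain ⟨c, rfl⟩ := Submodule.mem_span_singleton.1 hy
      exact ⟨(b, c), ⟨hb, Set.mem_univ _⟩, rfl⟩
    · rintro ⟨x⟩ s hs
      -- If `s` fixes the orbit of `x`, some `m * r + s` fixes `x`, hence lies in `B`.
      obtain ⟨m, hm⟩ := (centralQuotient_mk_eq_iff t (φ (Multiplicative.ofAdd s) • x) x).1 hs
      rw [htpow, smul_smul, ← map_mul, ← ofAdd_add] at hm
      refine Submodule.mem_sup.2 ⟨_, hX x _ hm, _,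
        Submodule.smul_mem _ (-m : ℚ) (Submodule.mem_span_singleton_self r), ?_⟩
      rw [Rat.smul_def]
      push_cast
      ring

end Rep

/-! ### Vanishing passes from a normal subgroup to the group. -/

namespace Rep

open CategoryTheory Limits groupCohomology

variable {k G : Type} [CommRing k] [Group G]

lemma inhomogeneousCochains_d_comp {A B : Rep.{0} k G} (f : B →ₗ[k] A)
    (hf : ∀ g b, f (B.ρ g b) = A.ρ g (f b)) (n : ℕ) (x : (Fin n → G) → B) (g : Fin (n + 1) → G) :
    inhomogeneousCochains.d A n (fun h => f (x h)) g = f (inhomogeneousCochains.d B n x g) := by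
  change A.ρ _ _ + _ = f (B.ρ _ _ + _)
  rw [map_add, hf, map_sum]
  simp

/-- If the cohomology of `A` vanishes in some degree, then so does that of a power of `A`. -/
lemma isZero_of_equiv_pi {A B : Rep.{0} k G} {W : Type} (e : B ≃ₗ[k] (W → A))
    (he : ∀ g b w, e (B.ρ g b) w = A.ρ g (e b w)) (n : ℕ) (hA : IsZero (groupCohomology A n)) :
    IsZero (groupCohomology B n) := by
  cases n with
  | zero =>
    rw [isZero_zero_iff] at hA ⊢
    intro b hb
    refine e.map_eq_zero_iff.1 (funext fun w => hA _ fun g => ?_)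
    rw [← he, hb]
  | succ n =>
    rw [isZero_succ_iff] at hA ⊢
    intro x hx
    have hd (w : W) (m : ℕ) (z : (Fin m → G) → B) (g : Fin (m + 1) → G) :
        inhomogeneousCochains.d A m (fun h => e (z h) w) g =
          e (inhomogeneousCochains.d B m z g) w :=
      inhomogeneousCochains_d_comp (LinearMap.proj w ∘ₗ e.toLinearMap) (fun g b => he g b w) m z g
    choose y hy using fun w : W => hA (fun h => e (x h) w) (by
      ext g
      rw [hd, hx]
      exact congrFun (map_zero e) w)
    refine ⟨fun h => e.symm fun w => y w h, ?_⟩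
    ext g
    apply e.injective
    ext w
    rw [← hd]
    simp only [LinearEquiv.apply_symm_apply]
    exact congrFun (hy w) g

/-- Equivariance gives `f (n * g) = n • f g`, and normality identifies left and right cosets; so
`g⁻¹ • f g` descends to `G ⧸ N`. -/
lemma coind_inv_apply_congr {N : Subgroup G} [N.Normal] {A : Rep.{0} k G}
    (f : coind N.subtype (res N.subtype A)) {g h : G} (hgh : (g : G ⧸ N) = h) :
    A.ρ g⁻¹ (f.1 g) = A.ρ h⁻¹ (f.1 h) := by
  have hn : h * g⁻¹ ∈ N := (Subgroup.Normal.mem_comm_iff inferInstance).1 (QuotientGroup.eq.1 hgh)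
  have hf : f.1 (h * g⁻¹ * g) = A.ρ (h * g⁻¹) (f.1 g) := f.2 ⟨_, hn⟩ g
  rw [inv_mul_cancel_right] at hf
  rw [hf, ← Module.End.mul_apply, ← map_mul, inv_mul_cancel_left]

/-- The restriction to a normal subgroup `N` of the representation coinduced from `N`
is a power of the representation. -/
noncomputable def resCoindEquiv (N : Subgroup G) [N.Normal] (A : Rep.{0} k G) :
    res N.subtype (coind N.subtype (res N.subtype A)) ≃ₗ[k] (G ⧸ N → A) where
  toFun f w := A.ρ w.out⁻¹ (f.1 w.out)
  map_add' f f' := by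
    ext w
    exact map_add (A.ρ w.out⁻¹) _ _
  map_smul' c f := by
    ext w
    exact map_smul (A.ρ w.out⁻¹) c _
  invFun b := ⟨fun g => A.ρ g (b g), fun n g => by
    have : ((N.subtype n * g : G) : G ⧸ N) = g := by
      rw [QuotientGroup.mk_mul, (QuotientGroup.eq_one_iff (N.subtype n)).2 n.2, one_mul]
    change A.ρ (N.subtype n * g) (b (N.subtype n * g : G)) = A.ρ n (A.ρ g (b g))
    rw [this, map_mul]
    rfl⟩
  left_inv f := by
    apply Subtype.ext
    ext g
    change A.ρ g (A.ρ (g : G ⧸ N).out⁻¹ (f.1 (g : G ⧸ N).out)) = f.1 g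
    rw [coind_inv_apply_congr f (QuotientGroup.out_eq' (g : G ⧸ N))]
    simp
  right_inv b := by
    ext w
    simp

lemma resCoindEquiv_apply (N : Subgroup G) [N.Normal] (A : Rep.{0} k G) (n : N)
    (f : res N.subtype (coind N.subtype (res N.subtype A))) (w : G ⧸ N) :
    resCoindEquiv N A ((res N.subtype (coind N.subtype (res N.subtype A))).ρ n f) w =
      A.ρ n (resCoindEquiv N A f w) := by
  change A.ρ w.out⁻¹ (f.1 (w.out * n)) = A.ρ n (A.ρ w.out⁻¹ (f.1 w.out))
  rw [coind_inv_apply_congr f (g := w.out) (h := w.out * n) (by simp)]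
  simp [← Module.End.mul_apply, ← map_mul]

/-- If the cohomology of a representation vanishes on a normal subgroup, then it vanishes. -/
theorem isZero_of_normal (N : Subgroup G) [N.Normal] (n : ℕ) (A : Rep.{0} k G)
    (hA : ∀ q, IsZero (groupCohomology (res N.subtype A) q)) :
    IsZero (groupCohomology A n) := by
  have hS := coindSequence_shortExact N A
  induction n generalizing A with
  | zero =>
    have h0 : IsZero (groupCohomology (coindSequence N A).X₂ 0) :=
      (hA 0).of_iso (groupCohomology.coindIso _ _)
    exact h0.of_mono (groupCohomology.map (MonoidHom.id G) (toCoindRes N A) 0)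
  | succ n ih =>
    have hI (q : ℕ) : IsZero (groupCohomology (coindSequence N A).X₂ q) :=
      (hA q).of_iso (groupCohomology.coindIso _ _)
    -- By Shapiro the coinduced term is acyclic, which shifts the degree to the cokernel.
    have := isIso_δ_of_isZero hS n (hI n) (hI (n + 1))
    refine (ih (coindSequence N A).X₃ (fun q => ?_) (coindSequence_shortExact N _)).of_iso
      (asIso (δ hS n (n + 1) rfl)).symm
    -- The cokernel is again acyclic over `N`: it sits between a power of `A` and `A` in the long
    -- exact sequence.
    have hR := (shortExact_res N.subtype).2 hS
    exact (mapShortComplex₃_exact hR (rfl : q + 1 = q + 1)).isZero_of_both_zeros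
      ((isZero_of_equiv_pi (A := res N.subtype A) (resCoindEquiv N A)
        (resCoindEquiv_apply N A) q (hA q)).eq_of_src _ _) ((hA (q + 1)).eq_of_tgt _ _)

end Rep

/-! ### Part (a): translations. -/

/-- The real multiples of the all-ones vector. -/
noncomputable def diagonalTranslation (p : ℕ) : Multiplicative ℝ →* Multiplicative (Fin p → ℝ) :=
  AddMonoidHom.toMultiplicative
    { toFun := fun r _ => r, map_zero' := rfl, map_add' := fun _ _ => rfl }

theorem isZero_groupCohomology_leftRegular {p : ℕ} (hp : 0 < p) (k : ℕ) :
    CategoryTheory.Limits.IsZero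
      (groupCohomology (Rep.leftRegular ℂ (Multiplicative (Fin p → ℝ))) k) := by
  refine Rep.isZero_ofMulAction_of_countable_stabilizers (diagonalTranslation p)
    (fun r => Subgroup.mem_center_iff.2 fun g => mul_comm _ _) k _ ⊥ (by simp) ?_
  intro x r h
  exact congrFun (mul_eq_right.1 h : diagonalTranslation p (Multiplicative.ofAdd r) = 1) ⟨0, hp⟩

/-! ### The unipotent subgroup and its shears. -/

namespace MPar

variable {n : ℕ}

/-- The normal subgroup of `MPar n` of pairs `(A, 1)` with `A` block unipotent. -/
def unipotent (n : ℕ) : Subgroup (MPar n) where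
  carrier := {g | ∃ a : Matrix (Fin n) (Fin n) ℝ, g.1.1.1 = fromBlocks 1 a 0 1 ∧ g.1.2 = 1}
  one_mem' := ⟨0, by simp, rfl⟩
  mul_mem' := by
    rintro g h ⟨a, ha, hg⟩ ⟨b, hb, hh⟩
    refine ⟨b + a, ?_, by simp [hg, hh]⟩
    change g.1.1.1 * h.1.1.1 = _
    simp [ha, hb, fromBlocks_multiply]
  inv_mem' := by
    rintro g ⟨a, ha, hg⟩
    refine ⟨-a, ?_, by simp [hg]⟩
    have h1 : g.1.1.1 * (g⁻¹).1.1.1 = 1 :=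
      congrArg (fun g : MPar n => g.1.1.1) (mul_inv_cancel g)
    have h2 : fromBlocks 1 (-a) 0 1 * g.1.1.1 = 1 := by
      rw [ha, fromBlocks_multiply]
      simp
    exact (left_inv_eq_right_inv h2 h1).symm

lemma isUnit_det_of_mem (g : MPar n) {b a : Matrix (Fin n) (Fin n) ℝ}
    (h : g.1.1.1 = fromBlocks b a 0 (b⁻¹)ᵀ) : IsUnit b.det := by
  have h1 : g.1.1.1.det * (g⁻¹).1.1.1.det = 1 := by
    rw [← det_mul]
    exact (congrArg (fun g : MPar n => g.1.1.1.det) (mul_inv_cancel g)).trans det_one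
  rw [h, det_fromBlocks_zero₂₁, mul_assoc] at h1
  exact IsUnit.of_mul_eq_one _ h1

instance unipotent_normal (n : ℕ) : (unipotent n).Normal where
  conj_mem := by
    rintro g ⟨a, ha, hg⟩ h
    obtain ⟨b, c, hb, hz⟩ := h.2
    have hu := isUnit_det_of_mem h hb
    have hut : IsUnit (bᵀ).det := by rwa [det_transpose]
    have h1 : h.1.1.1 * (h⁻¹).1.1.1 = 1 :=
      congrArg (fun g : MPar n => g.1.1.1) (mul_inv_cancel h)
    refine ⟨b * a * bᵀ, ?_, by simp [hg]⟩
    change h.1.1.1 * g.1.1.1 * (h⁻¹).1.1.1 = _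
    have h2 : h.1.1.1 * g.1.1.1 = fromBlocks 1 (b * a * bᵀ) 0 1 * h.1.1.1 := by
      rw [hb, ha, fromBlocks_multiply, fromBlocks_multiply, transpose_nonsing_inv]
      simp [Matrix.mul_assoc, mul_nonsing_inv _ hut, add_comm]
    rw [h2, Matrix.mul_assoc, h1, Matrix.mul_one]

lemma unipotent_mul_comm (g h : unipotent n) : g * h = h * g := by
  obtain ⟨a, ha, hg⟩ := g.2
  obtain ⟨b, hb, hh⟩ := h.2
  refine Subtype.ext (Subtype.ext (Prod.ext (Subtype.ext ?_) (mul_comm _ _)))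
  change g.1.1.1.1 * h.1.1.1.1 = h.1.1.1.1 * g.1.1.1.1
  rw [ha, hb]
  simp [fromBlocks_multiply, add_comm]

lemma scalarShear_mem (n : ℕ) (r : ℝ) :
    fromBlocks 1 (r • (1 : Matrix (Fin n) (Fin n) ℝ)) 0 1 ∈ symplecticGroup (Fin n) ℝ := by
  rw [SymplecticGroup.mem_iff, J, fromBlocks_transpose, fromBlocks_multiply, fromBlocks_multiply]
  simp

/-- The shears `(x, ξ) ↦ (x + r ξ, ξ)` as a one-parameter subgroup. -/
noncomputable def scalarShear (n : ℕ) : Multiplicative ℝ →* unipotent n where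
  toFun r := ⟨⟨(⟨_, scalarShear_mem n r.toAdd⟩, 1), 1, r.toAdd • 1, by simp, by simp⟩,
    r.toAdd • 1, rfl, rfl⟩
  map_one' := by
    refine Subtype.ext (Subtype.ext (Prod.ext (Subtype.ext ?_) rfl))
    change fromBlocks 1 ((0 : ℝ) • 1) 0 1 = (1 : Matrix _ _ ℝ)
    simp
  map_mul' r s := by
    refine Subtype.ext (Subtype.ext (Prod.ext (Subtype.ext ?_) (mul_one 1).symm))
    change fromBlocks 1 ((r.toAdd + s.toAdd) • 1) 0 1 =
      fromBlocks 1 (r.toAdd • 1) 0 1 * fromBlocks 1 (s.toAdd • 1) 0 (1 : Matrix _ _ ℝ)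
    simp [fromBlocks_multiply, add_smul, add_comm]

end MPar

/-! ### Fixed points and stabilizers of Lagrangians. -/

namespace LagrangianGrassmannian

variable {n : ℕ}

lemma ext_of_le {L L' : LagrangianGrassmannian n} (h : L.1 ≤ L'.1) : L = L' := by
  refine Subtype.ext (le_antisymm h ?_)
  rw [← L.2, ← L'.2]
  exact LinearMap.BilinForm.orthogonal_le h

lemma symplecticForm_sumElim (x ξ y η : Fin n → ℝ) :
    symplecticForm n (Sum.elim x ξ) (Sum.elim y η) = ξ ⬝ᵥ y - x ⬝ᵥ η := by
  rw [symplecticForm, toBilin'_apply', J, fromBlocks_mulVec]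
  simp [dotProduct, Fintype.sum_sum_type, neg_mulVec]
  ring

/-- The form vanishes on `ξ = 0`, so each subspace lies in the orthogonal of the other. -/
lemma eq_of_forall_inr_eq_zero {L L' : LagrangianGrassmannian n}
    (hL : ∀ v ∈ L.1, ∀ i, v (Sum.inr i) = 0) (hL' : ∀ v ∈ L'.1, ∀ i, v (Sum.inr i) = 0) :
    L = L' := by
  refine ext_of_le fun v hv => ?_
  rw [← L'.2, LinearMap.BilinForm.mem_orthogonal_iff]
  intro w hw
  have h1 : v ∘ Sum.inr = 0 := funext (hL v hv)
  have h2 : w ∘ Sum.inr = 0 := funext (hL' w hw)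
  rw [← Sum.elim_comp_inl_inr v, ← Sum.elim_comp_inl_inr w,
    symplecticForm_sumElim, h1, h2]
  simp

/-- A Lagrangian subspace inside the subspace `ξ = 0` is fixed by `MPar n`. -/
lemma smul_eq_of_forall_inr_eq_zero {L : LagrangianGrassmannian n}
    (hL : ∀ v ∈ L.1, ∀ i, v (Sum.inr i) = 0) (g : MPar n) : g • L = L := by
  obtain ⟨b, a, hb, -⟩ := g.2
  refine eq_of_forall_inr_eq_zero ?_ hL
  rintro _ ⟨v, hv, rfl⟩ i
  have h1 : v ∘ Sum.inr = 0 := funext (hL v hv)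
  change (g.1.1.1 *ᵥ v) (Sum.inr i) = 0
  rw [hb, fromBlocks_mulVec, h1]
  simp

/-- For `v = (x, ξ)` in `L`, shearing and subtracting `v` puts `(r ξ, 0)` in `L`; pairing with `v`
yields `r |ξ|² = 0`. -/
lemma eq_zero_of_scalarShear_smul_eq {L : LagrangianGrassmannian n} {v : Fin n ⊕ Fin n → ℝ}
    (hv : v ∈ L.1) {i : Fin n} (hi : v (Sum.inr i) ≠ 0) {r : ℝ}
    (h : (MPar.scalarShear n (Multiplicative.ofAdd r) : MPar n) • L = L) : r = 0 := by
  have hmem : fromBlocks 1 (r • (1 : Matrix (Fin n) (Fin n) ℝ)) 0 1 *ᵥ v ∈ L.1 :=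
    (congrArg Subtype.val h).le ⟨v, hv, rfl⟩
  have hsub : Sum.elim (r • (v ∘ Sum.inr)) 0 ∈ L.1 := by
    convert L.1.sub_mem hmem hv using 1
    rw [fromBlocks_mulVec]
    ext (j | j) <;> simp [smul_mulVec]
  rw [← L.2, LinearMap.BilinForm.mem_orthogonal_iff] at hsub
  have h0 := hsub v hv
  rw [← Sum.elim_comp_inl_inr v, symplecticForm_sumElim] at h0
  simp only [Sum.elim_comp_inr, dotProduct_smul, dotProduct_zero, sub_zero, smul_eq_mul] at h0
  refine (mul_eq_zero.1 h0).resolve_right fun h1 => hi ?_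
  exact congrFun (dotProduct_self_eq_zero.1 h1) i

end LagrangianGrassmannian

theorem isZero_groupCohomology_orbit {n : ℕ} (L : LagrangianGrassmannian n)
    (hL : (MulAction.orbit (MPar n) L).Nontrivial) (k : ℕ) :
    CategoryTheory.Limits.IsZero
      (groupCohomology (Rep.ofMulAction ℂ (MPar n) (MulAction.orbit (MPar n) L)) k) := by
  refine Rep.isZero_of_normal (MPar.unipotent n) k _ fun q => ?_
  refine Rep.isZero_ofMulAction_of_countable_stabilizers (MPar.scalarShear n)
    (fun r => Subgroup.mem_center_iff.2 fun g => MPar.unipotent_mul_comm _ _) q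
    (MulAction.orbit (MPar n) L) ⊥ (by simp) ?_
  rintro ⟨M, hM⟩ r h
  have h' : (MPar.scalarShear n (Multiplicative.ofAdd r) : MPar n) • M = M := congrArg Subtype.val h
  by_cases hM0 : ∀ v ∈ M.1, ∀ i, v (Sum.inr i) = 0
  · exfalso
    have hfix := LagrangianGrassmannian.smul_eq_of_forall_inr_eq_zero hM0
    rw [← MulAction.orbit_eq_iff.2 hM] at hL
    obtain ⟨_, ⟨g, rfl⟩, _, ⟨g', rfl⟩, hne⟩ := hL
    exact hne ((hfix g).trans (hfix g').symm)
  · push Not at hM0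
    obtain ⟨v, hv, i, hi⟩ := hM0
    exact LagrangianGrassmannian.eq_zero_of_scalarShear_smul_eq hv hi h'

theorem mainTheorem7 :
    (∀ p : ℕ, 0 < p → ∀ k : ℕ,
      CategoryTheory.Limits.IsZero
        (groupCohomology (Rep.leftRegular ℂ (Multiplicative (Fin p → ℝ))) k)) ∧
    (∀ (n : ℕ) (L : LagrangianGrassmannian n),
      (MulAction.orbit (MPar n) L).Nontrivial → ∀ k : ℕ,
        CategoryTheory.Limits.IsZero
          (groupCohomology (Rep.ofMulAction ℂ (MPar n) (MulAction.orbit (MPar n) L)) k)) :=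
  ⟨fun _ hp k => isZero_groupCohomology_leftRegular hp k,
    fun _ L hL k => isZero_groupCohomology_orbit L hL k⟩
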